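/- Let $e \ge 1$ and $r \ge 2$ be integers, and let $B^{\oplus}(e,e,r)$ be the monoid presented by the generators $t_i$ ($i \in \mathbb{Z}/e$) and $s_3, \dots, s_r$, subject to the relations - $s_i s_j s_i = s_j s_i s_j$ for $3 \le i,j \le r$, $|i-j| = 1$; - $s_i s_j = s_j s_i$ for $3 \le i,j \le r$, $|i-j| > 1$; - $s_3 t_i s_3 = t_i s_3 t_i$ for $i \in \mathbb{Z}/e$ (if $r \ge 3$); - $s_j t_i = t_i s_j$ for $i \in \mathbb{Z}/e$ and $4 \le j \le r$; - $t_i t_{i-1} = t_j t_{j-1}$ for $i, j \in \mathbb{Z}/e$. Let $\tau = t_i t_{i-1}$ (which does not depend on $i$), $\Lambda_2 = \tau$, $\Lambda_p = s_p \cdots s_3\, \tau\, s_3 \cdots s_p$ for $3 \le p \le r$, and $\Delta = \Lambda_2 \Lambda_3 \cdots \Lambda_r$. In a monoid, $x$ left-divides (resp. right-divides) $y$ if $y = xz$ (resp. $y = zx$) for some $z$. A right lcm of a set is a common right multiple (an element left-divisible by all members of the set) that left-divides every common right multiple; a left gcd is a common left divisor that is left-divisible by every common left divisor; left lcm's and right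 gcd's are defined symmetrically. A Garside element of a monoid is an element whose left and right divisors coincide, are finite in number and generate the monoid. A Garside monoid is a cancellative monoid with no invertible element other than $1$ in which any two elements have left and right lcm's and left and right gcd's, and which has a Garside element. Then $B^{\oplus}(e,e,r)$ is a Garside monoid, and $\Delta$ is a Garside element of it. If moreover $e \ge 2$, then $\Delta$ is both the right lcm and the left lcm of the set of generators $\{t_i \mid i \in \mathbb{Z}/e\} \cup \{s_3, \dots, s_r\}$, and it is the minimal Garside element: $\Delta$ left-divides every Garside element of $B^{\oplus}(e,e,r)$. -/

import Mathlib

namespace Garside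

section Divisibility

variable {M : Type*} [Monoid M]

/-- `x` right-divides `y`, i.e. `y = z * x` for some `z`.
(`x` left-divides `y`, i.e. `y = x * z` for some `z`, is Mathlib's `x ∣ y`.) -/
def RightDvd (x y : M) : Prop := ∃ z, y = z * x

/-- `m` is a right lcm of `S`: a least common right multiple, for left divisibility. -/
def IsRightLcm (S : Set M) (m : M) : Prop :=
  (∀ x ∈ S, x ∣ m) ∧ ∀ n, (∀ x ∈ S, x ∣ n) → m ∣ n

/-- `m` is a left lcm of `S`: a least common left multiple, for right divisibility. -/
def IsLeftLcm (S : Set M) (m : M) : Prop :=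
  (∀ x ∈ S, RightDvd x m) ∧ ∀ n, (∀ x ∈ S, RightDvd x n) → RightDvd m n

/-- `d` is a left gcd of `S`: a greatest common left divisor. -/
def IsLeftGcd (S : Set M) (d : M) : Prop :=
  (∀ x ∈ S, d ∣ x) ∧ ∀ c, (∀ x ∈ S, c ∣ x) → c ∣ d

/-- `d` is a right gcd of `S`: a greatest common right divisor. -/
def IsRightGcd (S : Set M) (d : M) : Prop :=
  (∀ x ∈ S, RightDvd d x) ∧ ∀ c, (∀ x ∈ S, RightDvd c x) → RightDvd c d

/-- A Garside element: its left and right divisors coincide, are finite in number and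
generate the monoid. -/
structure IsGarsideElement (g : M) : Prop where
  balanced : ∀ x, x ∣ g ↔ RightDvd x g
  finite : {x : M | x ∣ g}.Finite
  generates : Submonoid.closure {x : M | x ∣ g} = ⊤

end Divisibility

/-- A Garside monoid: a cancellative monoid with (left and right) lcm's and gcd's, admitting a
Garside element. The condition on units is what makes lcm's and gcd's unique, i.e. well-defined
elements of the monoid. -/
structure IsGarsideMonoid (M : Type*) [Monoid M] : Prop where
  cancel : IsCancelMul M
  eq_one_of_isUnit : ∀ u : M, IsUnit u → u = 1
  exists_rightLcm : ∀ x y : M, ∃ m, IsRightLcm {x, y} m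
  exists_leftLcm : ∀ x y : M, ∃ m, IsLeftLcm {x, y} m
  exists_leftGcd : ∀ x y : M, ∃ d, IsLeftGcd {x, y} d
  exists_rightGcd : ∀ x y : M, ∃ d, IsRightGcd {x, y} d
  exists_garsideElement : ∃ g : M, IsGarsideElement g

/-- The generators `t_i` for `i ∈ ℤ/e`, and `s_3, …, s_r`. -/
inductive Gen (e r : ℕ) : Type
  | t (i : ZMod e) : Gen e r
  | s (j : Set.Icc 3 r) : Gen e r

section Presentation

open FreeMonoid (of)
open Gen

/-- The defining relations of type `(e, e, r)`. -/
inductive Rel (e r : ℕ) : FreeMonoid (Gen e r) → FreeMonoid (Gen e r) → Prop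
  | R1 (i j : Set.Icc 3 r) (h : |((i : ℕ) : ℤ) - ((j : ℕ) : ℤ)| = 1) :
      Rel e r (of (s i) * of (s j) * of (s i)) (of (s j) * of (s i) * of (s j))
  | R2 (i j : Set.Icc 3 r) (h : 1 < |((i : ℕ) : ℤ) - ((j : ℕ) : ℤ)|) :
      Rel e r (of (s i) * of (s j)) (of (s j) * of (s i))
  | R3 (j : Set.Icc 3 r) (h : (j : ℕ) = 3) (i : ZMod e) :
      Rel e r (of (s j) * of (t i) * of (s j)) (of (t i) * of (s j) * of (t i))
  | R4 (j : Set.Icc 3 r) (h : 4 ≤ (j : ℕ)) (i : ZMod e) :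
      Rel e r (of (s j) * of (t i)) (of (t i) * of (s j))
  | R5 (i j : ZMod e) :
      Rel e r (of (t i) * of (t (i - 1))) (of (t j) * of (t (j - 1)))

end Presentation

/-- The monoid `B⊕(e, e, r)` with generators `Gen e r` and relations `Rel e r`. -/
abbrev BraidMonoid (e r : ℕ) : Type := PresentedMonoid (Rel e r)

/-- The element `t_i` of the monoid. -/
def t (e r : ℕ) (i : ZMod e) : BraidMonoid e r := PresentedMonoid.of (Rel e r) (Gen.t i)

/-- The element `s_j` of the monoid, for `3 ≤ j ≤ r`. -/
def s (e r : ℕ) (j : ℕ) (h3 : 3 ≤ j) (hr : j ≤ r) : BraidMonoid e r :=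
  PresentedMonoid.of (Rel e r) (Gen.s ⟨j, h3, hr⟩)

/-- The element `τ = t_1 t_0`, equal to `t_i t_{i-1}` for every `i` by relation `R5`. -/
def tau (e r : ℕ) : BraidMonoid e r := t e r 1 * t e r 0

/-- `Lam e r k _` is `Λ_{k+2}`: `Λ_2 = τ` and `Λ_p = s_p ⋯ s_3 τ s_3 ⋯ s_p` for `3 ≤ p ≤ r`. -/
def Lam (e r : ℕ) : (k : ℕ) → k + 2 ≤ r → BraidMonoid e r
  | 0, _ => tau e r
  | k + 1, h =>
      s e r (k + 3) (by omega) (by omega) * Lam e r k (by omega) *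
        s e r (k + 3) (by omega) (by omega)

/-- `Δ = Λ_2 Λ_3 ⋯ Λ_r`. -/
def Delta (e r : ℕ) : BraidMonoid e r :=
  (List.ofFn fun k : Fin (r - 1) => Lam e r k (by omega)).prod

/-- The set `T_e ∪ S_r` of the generators, as elements of the monoid. -/
def generators (e r : ℕ) : Set (BraidMonoid e r) := Set.range (PresentedMonoid.of (Rel e r))

end Garside

/-
The relations are complemented: for each pair of generators `a`, `b` they contain one equation
`a * c a b = b * c b a`. Dehornoy's cube condition on triples of generators implies, by induction on
the length of the common multiples, that its two sides are the right lcm of `a` and `b`. Left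
cancellation is the case `a = b`, and pasting such squares into grids gives the right lcm of any two
elements that have a common right multiple. For `k ≥ 3` one has `Λ_k * t_{i-1} = t_i * Λ_k`, and
`Λ_k` commutes with `s_j` for `3 ≤ j < k`; it follows that `Δ` permutes the generators by
conjugation, so any two elements have a power of `Δ` as a common multiple. The left-handed
statements follow by the anti-automorphism `t_i ↦ t_{-i}`, `s_j ↦ s_j`. For `e ≥ 2` the grids show
that `Λ_2 ⋯ Λ_k` is the right lcm of `Λ_2 ⋯ Λ_{k-1}` and `s_k`, so that `Δ` is the right lcm of the
generators; these are irreducible, hence divide every Garside element.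
-/

namespace Garside

/-! ### Lengths and Garside elements -/

section General

open Submonoid (closure)

variable {M : Type*} [Monoid M]

theorem exists_eq_mul_of_closure_eq_top {S : Set M} (hS : closure S = ⊤) (x : M) :
    x = 1 ∨ ∃ a ∈ S, a ≠ 1 ∧ ∃ y, x = a * y := by
  induction x using Submonoid.induction_of_closure_eq_top_left hS with
  | one => exact .inl rfl
  | mul_left a ha y ih =>
    rcases eq_or_ne a 1 with rfl | ha1
    · simpa only [one_mul] using ih
    · exact .inr ⟨a, ha, ha1, y, rfl⟩

theorem mem_of_irreducible_of_closure_eq_top {S : Set M} (hS : closure S = ⊤)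
    (hunit : ∀ u : M, IsUnit u → u = 1) {a : M} (ha : Irreducible a) : a ∈ S := by
  obtain rfl | ⟨b, hb, hb1, y, rfl⟩ := exists_eq_mul_of_closure_eq_top hS a
  · exact absurd isUnit_one ha.not_isUnit
  · obtain hu | hu := ha.isUnit_or_isUnit rfl
    · exact absurd (hunit b hu) hb1
    · rwa [hunit y hu, mul_one]

/-- A length on a monoid: an additive function which vanishes only at `1`. -/
structure IsAdditiveLength (len : M → ℕ) : Prop where
  map_mul : ∀ x y, len (x * y) = len x + len y
  eq_one_of_eq_zero : ∀ {x}, len x = 0 → x = 1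

namespace IsAdditiveLength

variable {len : M → ℕ} (hlen : IsAdditiveLength len)
include hlen

theorem map_one : len 1 = 0 := by
  have h := hlen.map_mul 1 1
  rw [one_mul] at h
  omega

theorem pos {x : M} (hx : x ≠ 1) : 0 < len x :=
  Nat.pos_of_ne_zero fun h => hx (hlen.eq_one_of_eq_zero h)

theorem le_of_dvd {x y : M} (h : x ∣ y) : len x ≤ len y := by
  obtain ⟨z, rfl⟩ := h
  exact hlen.map_mul x z ▸ Nat.le_add_right ..

theorem mem_le_of_mul_mem_le (n : ℕ) (x y : M) (h : x * y ∈ {z | len z ≤ n}) :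
    y ∈ {z | len z ≤ n} :=
  (Nat.le_add_left (len y) (len x)).trans (hlen.map_mul x y ▸ h)

theorem eq_one_of_isUnit (x : M) (hx : IsUnit x) : x = 1 := by
  obtain ⟨y, hy⟩ := hx.exists_right_inv
  have h := hlen.map_mul x y
  rw [hy, hlen.map_one] at h
  exact hlen.eq_one_of_eq_zero (by omega)

theorem irreducible_of_eq_one {x : M} (hx : len x = 1) : Irreducible x where
  not_isUnit h := by
    rw [hlen.eq_one_of_isUnit x h, hlen.map_one] at hx
    exact zero_ne_one hx
  isUnit_or_isUnit := by
    rintro y z rfl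
    rw [hlen.map_mul] at hx
    obtain h | h : len y = 0 ∨ len z = 0 := by omega
    · exact .inl (hlen.eq_one_of_eq_zero h ▸ isUnit_one)
    · exact .inr (hlen.eq_one_of_eq_zero h ▸ isUnit_one)

theorem finite_setOf_le {S : Set M} (hfin : S.Finite) (hS : closure S = ⊤) (n : ℕ) :
    {x | len x ≤ n}.Finite := by
  induction n with
  | zero =>
    exact (Set.finite_singleton 1).subset fun x hx => hlen.eq_one_of_eq_zero (Nat.le_zero.1 hx)
  | succ n ih =>
    refine ((Set.finite_singleton 1).union (hfin.image2 (· * ·) ih)).subset fun x hx => ?_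
    obtain rfl | ⟨a, ha, ha1, y, rfl⟩ := exists_eq_mul_of_closure_eq_top hS x
    · exact .inl rfl
    · have hpos := hlen.pos ha1
      have hmul := hlen.map_mul a y
      exact .inr ⟨a, ha, y, by simp only [Set.mem_ofPred_eq] at hx ⊢; omega, rfl⟩

theorem exists_isLeftGcd (hlcm : ∀ x y : M, ∃ m, IsRightLcm {x, y} m) (x y : M) :
    ∃ d, IsLeftGcd {x, y} d := by
  -- A common divisor of greatest length: its lcm with any other one is not longer.
  obtain ⟨d, ⟨hdx, hdy⟩, hmax⟩ :
      ∃ d, (d ∣ x ∧ d ∣ y) ∧ ∀ c, c ∣ x ∧ c ∣ y → len c ≤ len d := by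
    have hbdd : BddAbove (len '' {d | d ∣ x ∧ d ∣ y}) :=
      ⟨len x, Set.forall_mem_image.2 fun d hd => hlen.le_of_dvd hd.1⟩
    have hne : (len '' {d | d ∣ x ∧ d ∣ y}).Nonempty := ⟨_, 1, ⟨one_dvd x, one_dvd y⟩, rfl⟩
    obtain ⟨d, hd, hdmax⟩ := Nat.sSup_mem hne hbdd
    exact ⟨d, hd, fun c hc => hdmax ▸ le_csSup hbdd ⟨c, hc, rfl⟩⟩
  refine ⟨d, by simp [hdx, hdy], fun c hc => ?_⟩
  simp only [Set.mem_insert_iff, Set.mem_singleton_iff, forall_eq_or_imp, forall_eq] at hc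
  obtain ⟨m, hm⟩ := hlcm d c
  simp only [IsRightLcm, Set.mem_insert_iff, Set.mem_singleton_iff, forall_eq_or_imp,
    forall_eq] at hm
  obtain ⟨⟨⟨k, rfl⟩, hcm⟩, hleast⟩ := hm
  have hle := hmax (d * k) ⟨hleast x ⟨hdx, hc.1⟩, hleast y ⟨hdy, hc.2⟩⟩
  rw [hlen.map_mul] at hle
  rwa [hlen.eq_one_of_eq_zero (x := k) (by omega), mul_one] at hcm

theorem star_eq_self_of_dvd [StarMul M] {x : M} (h : x ∣ star x) : star x = x := by
  obtain ⟨z, hz⟩ := h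
  have hx : x = star z * x * z := by rw [mul_assoc, ← hz, ← star_mul, ← hz, star_star]
  have hlen_x : len x = len (star z) + len x + len z := by
    rw [← hlen.map_mul, ← hlen.map_mul, ← hx]
  rw [hz, hlen.eq_one_of_eq_zero (x := z) (by omega), mul_one]

end IsAdditiveLength

namespace IsGarsideElement

variable {g : M} (hg : IsGarsideElement g)
include hg

theorem exists_mul_eq_mul_of_dvd {x : M} (hx : x ∣ g) : ∃ y, y ∣ g ∧ x * g = g * y := by
  obtain ⟨w, hw⟩ := hx
  obtain ⟨y, hy⟩ := (hg.balanced w).2 ⟨x, hw⟩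
  exact ⟨y, (hg.balanced y).2 ⟨w, hy⟩, by rw [hy, ← mul_assoc, ← hw, ← hy]⟩

theorem mul_pow_dvd_pow_succ {x : M} (hx : x ∣ g) (n : ℕ) : x * g ^ n ∣ g ^ (n + 1) := by
  induction n generalizing x with
  | zero => simpa using hx
  | succ n ih =>
    obtain ⟨y, hy, hxy⟩ := hg.exists_mul_eq_mul_of_dvd hx
    rw [pow_succ' g n, ← mul_assoc, hxy, mul_assoc, pow_succ' g (n + 1)]
    exact mul_dvd_mul_left g (ih hy)

theorem exists_dvd_pow (x : M) : ∃ n, x ∣ g ^ n := by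
  induction x using Submonoid.induction_of_closure_eq_top_left hg.generates with
  | one => exact ⟨0, one_dvd _⟩
  | mul_left a ha y ih =>
    obtain ⟨n, hn⟩ := ih
    exact ⟨n + 1, (mul_dvd_mul_left a hn).trans (hg.mul_pow_dvd_pow_succ ha n)⟩

theorem exists_mul_eq_mul (x y : M) : ∃ u v, x * u = y * v := by
  obtain ⟨m, hm⟩ := hg.exists_dvd_pow x
  obtain ⟨n, hn⟩ := hg.exists_dvd_pow y
  obtain ⟨u, hu⟩ := hm.trans (pow_dvd_pow g (le_max_left m n))
  obtain ⟨v, hv⟩ := hn.trans (pow_dvd_pow g (le_max_right m n))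
  exact ⟨u, v, hu.symm.trans hv⟩

end IsGarsideElement

theorem dvd_iff_rightDvd_of_semiconjBy [IsCancelMul M] {S : Set M} (hS : closure S = ⊤) {g : M}
    (hleft : ∀ a ∈ S, ∃ b, SemiconjBy g b a) (hright : ∀ a ∈ S, ∃ b, SemiconjBy g a b) (x : M) :
    x ∣ g ↔ RightDvd x g := by
  have extend {P : M → M → Prop} (one : P 1 1)
      (mul : ∀ {a b x y}, P a b → P x y → P (a * x) (b * y)) (hP : ∀ a ∈ S, ∃ b, P a b) (x : M) :
      ∃ y, P x y := by
    induction x using Submonoid.induction_of_closure_eq_top_left hS with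
    | one => exact ⟨1, one⟩
    | mul_left a ha x ih =>
      obtain ⟨b, hb⟩ := hP a ha
      obtain ⟨y, hy⟩ := ih
      exact ⟨b * y, mul hb hy⟩
  have hleft' := extend (P := fun x y => SemiconjBy g y x) (.one_right g) .mul_right hleft
  have hright' := extend (P := SemiconjBy g) (.one_right g) .mul_right hright
  constructor
  · rintro ⟨y, hy⟩
    obtain ⟨w, hw⟩ := hright' y
    refine ⟨w, mul_right_cancel (b := y) ?_⟩
    rw [hw.eq, mul_assoc, ← hy]
  · rintro ⟨y, hy⟩
    obtain ⟨w, hw⟩ := hleft' y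
    refine ⟨w, mul_left_cancel (a := y) ?_⟩
    rw [← hw.eq, ← mul_assoc, ← hy]

section Star

variable [StarMul M]

theorem rightDvd_iff_star_dvd_star {x y : M} : RightDvd x y ↔ star x ∣ star y := by
  constructor
  · rintro ⟨z, rfl⟩
    exact ⟨star z, star_mul z x⟩
  · rintro ⟨z, hz⟩
    exact ⟨star z, by rw [← star_star y, hz, star_mul, star_star]⟩

theorem isLeftLcm_iff_isRightLcm_star {S : Set M} {m : M} :
    IsLeftLcm S m ↔ IsRightLcm (star '' S) (star m) := by
  simp only [IsLeftLcm, IsRightLcm, rightDvd_iff_star_dvd_star, Set.forall_mem_image]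
  exact and_congr_right fun _ => star_involutive.surjective.forall (p := fun n =>
    (∀ x ∈ S, star x ∣ n) → star m ∣ n).symm

theorem isRightGcd_iff_isLeftGcd_star {S : Set M} {d : M} :
    IsRightGcd S d ↔ IsLeftGcd (star '' S) (star d) := by
  simp only [IsRightGcd, IsLeftGcd, rightDvd_iff_star_dvd_star, Set.forall_mem_image]
  exact and_congr_right fun _ => star_involutive.surjective.forall (p := fun c =>
    (∀ x ∈ S, c ∣ star x) → c ∣ star d).symm

theorem exists_isLeftLcm_of_star (hlcm : ∀ x y : M, ∃ m, IsRightLcm {x, y} m) (x y : M) :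
    ∃ m, IsLeftLcm {x, y} m := by
  obtain ⟨m, hm⟩ := hlcm (star x) (star y)
  exact ⟨star m, isLeftLcm_iff_isRightLcm_star.2 (by rwa [Set.image_pair, star_star])⟩

theorem exists_isRightGcd_of_star (hgcd : ∀ x y : M, ∃ d, IsLeftGcd {x, y} d) (x y : M) :
    ∃ d, IsRightGcd {x, y} d := by
  obtain ⟨d, hd⟩ := hgcd (star x) (star y)
  exact ⟨star d, isRightGcd_iff_isLeftGcd_star.2 (by rwa [Set.image_pair, star_star])⟩

theorem isCancelMul_of_star [IsLeftCancelMul M] : IsCancelMul M where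
  mul_right_cancel x y z h := star_injective <| mul_left_cancel (a := star x) <| by
    rw [← star_mul, ← star_mul]
    exact congrArg star h

theorem IsAdditiveLength.isGarsideMonoid [IsLeftCancelMul M] {len : M → ℕ}
    (hlen : IsAdditiveLength len) (hlcm : ∀ x y : M, ∃ m, IsRightLcm {x, y} m) {g : M}
    (hg : IsGarsideElement g) : IsGarsideMonoid M where
  cancel := isCancelMul_of_star
  eq_one_of_isUnit := hlen.eq_one_of_isUnit
  exists_rightLcm := hlcm
  exists_leftLcm := exists_isLeftLcm_of_star hlcm
  exists_leftGcd := hlen.exists_isLeftGcd hlcm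
  exists_rightGcd := exists_isRightGcd_of_star (hlen.exists_isLeftGcd hlcm)
  exists_garsideElement := ⟨g, hg⟩

end Star

/-! ### Lcm squares and the cube condition -/

/-- `p` and `q` complete `u` and `v` to an lcm square: `u * p = v * q`, and every common right
multiple of `u` and `v` that lies in `S` factors through it. Restricting to a set `S` lets one
establish such squares by induction on the length of the multiples. -/
structure IsLcmSquareOn (S : Set M) (u v p q : M) : Prop where
  mul_eq : u * p = v * q
  exists_factor : ∀ {x y}, u * x = v * y → u * x ∈ S → ∃ z, x = p * z ∧ y = q * z

namespace IsLcmSquareOn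

variable {S : Set M} {u v p q v' p' q' : M}

theorem one_left (v : M) : IsLcmSquareOn S 1 v v 1 where
  mul_eq := by rw [one_mul, mul_one]
  exists_factor {x y} h _ := ⟨y, by rwa [one_mul] at h, (one_mul y).symm⟩

theorem symm (h : IsLcmSquareOn S u v p q) : IsLcmSquareOn S v u q p where
  mul_eq := h.mul_eq.symm
  exists_factor hxy hS := (h.exists_factor hxy.symm (hxy ▸ hS)).imp fun _ => And.symm

theorem mul_right (hS : ∀ x y, x * y ∈ S → y ∈ S) (h : IsLcmSquareOn S u v p q)
    (h' : IsLcmSquareOn S q v' p' q') : IsLcmSquareOn S u (v * v') (p * p') q' where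
  mul_eq := by rw [← mul_assoc, h.mul_eq, mul_assoc, h'.mul_eq, mul_assoc]
  exists_factor {x y} hxy hmem := by
    rw [mul_assoc] at hxy
    obtain ⟨z, rfl, hz⟩ := h.exists_factor hxy hmem
    rw [hxy, hz] at hmem
    obtain ⟨w, rfl, rfl⟩ := h'.exists_factor hz.symm (hS _ _ hmem)
    exact ⟨w, (mul_assoc ..).symm, rfl⟩

theorem isRightLcm (h : IsLcmSquareOn Set.univ u v p q) : IsRightLcm {u, v} (u * p) := by
  simp only [IsRightLcm, Set.mem_insert_iff, Set.mem_singleton_iff, forall_eq_or_imp, forall_eq]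
  refine ⟨⟨dvd_mul_right u p, h.mul_eq ▸ dvd_mul_right v q⟩, ?_⟩
  rintro _ ⟨⟨x, rfl⟩, y, hxy⟩
  obtain ⟨z, rfl, -⟩ := h.exists_factor hxy trivial
  exact mul_dvd_mul_left u (dvd_mul_right p z)

end IsLcmSquareOn

/-- The squares `u * p = v * q` obtained by pasting the squares `ι a * c a b = ι b * c b a` side
by side, in the manner of a reversing grid: `p` and `q` are the complements of `u` and `v`
computed from the complements `c a b` of the letters. -/
inductive LcmGrid {A : Type*} (ι : A → M) (c : A → A → M) : M → M → M → M → Prop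
  | atom (a b : A) : LcmGrid ι c (ι a) (ι b) (c a b) (c b a)
  | one_left (v : M) : LcmGrid ι c 1 v v 1
  | symm {u v p q : M} : LcmGrid ι c u v p q → LcmGrid ι c v u q p
  | mul_right {u v p q v' p' q' : M} :
      LcmGrid ι c u v p q → LcmGrid ι c q v' p' q' → LcmGrid ι c u (v * v') (p * p') q'

section LcmGrid

variable {A : Type*} {ι : A → M} {c : A → A → M} {u v p q u' p' q' x y : M}

namespace LcmGrid

theorem one_right (u : M) : LcmGrid ι c u 1 1 u := (one_left u).symm

theorem mul_left (h : LcmGrid ι c u v p q) (h' : LcmGrid ι c u' p p' q') :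
    LcmGrid ι c (u * u') v p' (q * q') :=
  (h.symm.mul_right h'.symm).symm

theorem self (hι : closure (Set.range ι) = ⊤) (hc : ∀ a, c a a = 1) (u : M) :
    LcmGrid ι c u u 1 1 := by
  induction u using Submonoid.induction_of_closure_eq_top_left hι with
  | one => exact one_left 1
  | mul_left _ ha y ih =>
    obtain ⟨a, rfl⟩ := ha
    have haa : LcmGrid ι c (ι a) (ι a) 1 1 := hc a ▸ atom a a
    simpa only [one_mul] using
      (haa.mul_left (one_right y)).mul_right (p' := 1) (q' := 1) (by rwa [one_mul])

theorem isLcmSquareOn {S : Set M} (hS : ∀ x y, x * y ∈ S → y ∈ S)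
    (hatom : ∀ a b, IsLcmSquareOn S (ι a) (ι b) (c a b) (c b a)) (h : LcmGrid ι c u v p q) :
    IsLcmSquareOn S u v p q := by
  induction h with
  | atom a b => exact hatom a b
  | one_left v => exact .one_left v
  | symm _ ih => exact ih.symm
  | mul_right _ _ ih ih' => exact ih.mul_right hS ih'

theorem mul_eq (hc : ∀ a b, ι a * c a b = ι b * c b a) (h : LcmGrid ι c u v p q) :
    u * p = v * q :=
  (h.isLcmSquareOn (S := ∅) (fun _ _ => False.elim) fun a b => ⟨hc a b, fun _ => False.elim⟩).mul_eq

end LcmGrid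

theorem isLeftCancelMul_of_isLcmSquareOn (hι : closure (Set.range ι) = ⊤)
    (hatom : ∀ a, IsLcmSquareOn Set.univ (ι a) (ι a) 1 1) : IsLeftCancelMul M where
  mul_left_cancel x y z h := by
    replace h : x * y = x * z := h
    induction x using Submonoid.induction_of_closure_eq_top_left hι with
    | one => simpa only [one_mul] using h
    | mul_left _ ha x ih =>
      obtain ⟨a, rfl⟩ := ha
      rw [mul_assoc, mul_assoc] at h
      obtain ⟨w, hy, hz⟩ := (hatom a).exists_factor h trivial
      exact ih (hy.trans hz.symm)

theorem IsAdditiveLength.exists_lcmGrid {len : M → ℕ} (hlen : IsAdditiveLength len)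
    (hι : closure (Set.range ι) = ⊤)
    (hatom : ∀ a b, IsLcmSquareOn Set.univ (ι a) (ι b) (c a b) (c b a)) (h : u * x = v * y) :
    ∃ p q, LcmGrid ι c u v p q := by
  induction hn : len (u * x) using Nat.strong_induction_on generalizing u v x y with
  | _ n ih =>
    subst hn
    obtain rfl | ⟨_, ⟨a, rfl⟩, ha, u, rfl⟩ := exists_eq_mul_of_closure_eq_top hι u
    · exact ⟨v, 1, .one_left v⟩
    obtain rfl | ⟨_, ⟨b, rfl⟩, hb, v, rfl⟩ := exists_eq_mul_of_closure_eq_top hι v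
    · exact ⟨1, _, .one_right _⟩
    have square {u v p q x y : M} (huv : LcmGrid ι c u v p q) (hxy : u * x = v * y) :
        ∃ z, x = p * z ∧ y = q * z :=
      (huv.isLcmSquareOn (fun _ _ _ => trivial) hatom).exists_factor hxy trivial
    have hlen_a := hlen.pos ha
    have hlen_b := hlen.pos hb
    have hlen_u := hlen.map_mul (ι a) (u * x)
    have hlen_v := hlen.map_mul (ι b) (v * y)
    simp only [mul_assoc] at h ih ⊢
    rw [← h] at hlen_v
    obtain ⟨z, hux, hvy⟩ := square (.atom a b) h
    obtain ⟨p₁, q₁, h₁⟩ := ih _ (by omega) hux rfl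
    obtain ⟨p₂, q₂, h₂⟩ := ih _ (by rw [← hvy]; omega) hvy.symm rfl
    obtain ⟨w, -, hz⟩ := square h₁ hux
    obtain ⟨w', hz', -⟩ := square h₂ hvy.symm
    have hlen_z := hlen.map_mul (c a b) z
    obtain ⟨p₃, q₃, h₃⟩ := ih _ (by rw [← hz]; rw [← hux] at hlen_z; omega) (hz ▸ hz') rfl
    exact ⟨_, _, ((LcmGrid.atom a b).mul_left h₁).mul_right (h₂.mul_left h₃)⟩

/-- The cube condition at `d`: closing the grid of the lcm of `d, a` against the lcm of `d, b` gives
a common multiple of `a` and `b`, seen from `d`, that factors through the lcm of `a` and `b`. -/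
def CubeAt (ι : A → M) (c : A → A → M) (d a b : A) : Prop :=
  ∃ p q k, LcmGrid ι c (c d a) (c d b) p q ∧ c a d * p = c a b * k ∧ c b d * q = c b a * k

namespace CubeAt

theorem symm {d a b : A} : CubeAt ι c d a b → CubeAt ι c d b a := fun ⟨p, q, k, h, hp, hq⟩ =>
  ⟨q, p, k, h.symm, hq, hp⟩

theorem self_left (hc : ∀ a, c a a = 1) (a b : A) : CubeAt ι c a a b :=
  ⟨c a b, 1, 1, by rw [hc]; exact .one_left _, by rw [hc, one_mul, mul_one], rfl⟩

theorem self_right (hι : closure (Set.range ι) = ⊤) (hc : ∀ a, c a a = 1) (d a : A) :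
    CubeAt ι c d a a :=
  ⟨1, 1, c a d, .self hι hc _, by rw [hc, one_mul, mul_one], by rw [hc, one_mul, mul_one]⟩

theorem of_ne (hι : closure (Set.range ι) = ⊤) (hc : ∀ a, c a a = 1)
    (h : ∀ d a b, a ≠ d → b ≠ d → a ≠ b → CubeAt ι c d a b) (d a b : A) : CubeAt ι c d a b := by
  rcases eq_or_ne a d with rfl | had
  · exact .self_left hc a b
  rcases eq_or_ne b d with rfl | hbd
  · exact (CubeAt.self_left hc b a).symm
  rcases eq_or_ne a b with rfl | hab
  · exact .self_right hι hc d a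
  · exact h d a b had hbd hab

end CubeAt

end LcmGrid

end General

section Complement

open PresentedMonoid

variable {A : Type*} {R : FreeMonoid A → FreeMonoid A → Prop} {c : A → A → PresentedMonoid R}

/-- Two words start with letters `a` and `b`, and the elements they represent, when equal, are
multiples of `of R a * c a b = of R b * c b a` for the same cofactor. -/
inductive HeadsFactor (c : A → A → PresentedMonoid R) : FreeMonoid A → FreeMonoid A → Prop
  | one : HeadsFactor c 1 1
  | of_mul {a b : A} {x y : FreeMonoid A} {z : PresentedMonoid R} :
      mk R x = c a b * z → mk R y = c b a * z →
        HeadsFactor c (.of a * x) (.of b * y)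

/-- `c` is a right complement for the presentation `R`: the equations
`of R a * c a b = of R b * c b a` hold in the monoid and imply the relations of `R`. -/
structure IsComplement (c : A → A → PresentedMonoid R) : Prop where
  self : ∀ a, c a a = 1
  mul_eq : ∀ a b, of R a * c a b = of R b * c b a
  headsFactor : ∀ {u v}, R u v → HeadsFactor c u v

namespace HeadsFactor

variable {u v w u' v' x y : FreeMonoid A} {a b : A}

theorem exists_of_of_mul (h : HeadsFactor c (.of a * x) (.of b * y)) :
    ∃ z, mk R x = c a b * z ∧ mk R y = c b a * z := by
  generalize hu : FreeMonoid.of a * x = u, hv : FreeMonoid.of b * y = v at h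
  cases h with
  | one => nomatch hu
  | of_mul hx hy =>
    obtain ⟨rfl, rfl⟩ := List.cons.inj hu
    obtain ⟨rfl, rfl⟩ := List.cons.inj hv
    exact ⟨_, hx, hy⟩

theorem refl (hc : ∀ a, c a a = 1) (u : FreeMonoid A) : HeadsFactor c u u := by
  cases u using FreeMonoid.casesOn with
  | one => exact .one
  | of_mul a x =>
    have hx : mk R x = c a a * mk R x := by rw [hc, one_mul]
    exact .of_mul hx hx

theorem symm (h : HeadsFactor c u v) : HeadsFactor c v u := by
  cases h with
  | one => exact .one
  | of_mul hx hy => exact .of_mul hy hx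

theorem mul (h : HeadsFactor c u v) (h' : HeadsFactor c u' v') (huv : mk R u' = mk R v') :
    HeadsFactor c (u * u') (v * v') := by
  cases h with
  | one => simpa only [one_mul] using h'
  | of_mul hx hy =>
    rw [mul_assoc, mul_assoc]
    refine .of_mul (by rw [map_mul, hx, mul_assoc]) ?_
    rw [map_mul, hy, ← huv, mul_assoc]

theorem trans {S : Set (PresentedMonoid R)} (hS : ∀ x y, x * y ∈ S → y ∈ S)
    (hatom : ∀ a b, IsLcmSquareOn S (of R a) (of R b) (c a b) (c b a))
    (hcube : ∀ d a b, CubeAt (of R) c d a b)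
    (hmem : ∀ d x, v = .of d * x → mk R x ∈ S) (h : HeadsFactor c u v) (h' : HeadsFactor c v w) :
    HeadsFactor c u w := by
  cases h with
  | one => exact h'
  | @of_mul a d x y z₁ hx hy =>
    generalize hv : FreeMonoid.of d * y = v at h'
    cases h' with
    | one => nomatch hv
    | @of_mul d b y w z₂ hy' hw =>
      obtain ⟨rfl, rfl⟩ := List.cons.inj hv
      obtain ⟨p, q, k, hgrid, hp, hq⟩ := hcube d a b
      obtain ⟨z, rfl, rfl⟩ := (hgrid.isLcmSquareOn hS hatom).exists_factor (hy.symm.trans hy')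
        (hy ▸ hmem d y rfl)
      refine .of_mul (z := k * z) ?_ ?_
      · rw [hx, ← mul_assoc, hp, mul_assoc]
      · rw [hw, ← mul_assoc, hq, mul_assoc]

end HeadsFactor

namespace IsComplement

variable (hc : IsComplement c) {len : PresentedMonoid R → ℕ} (hlen : IsAdditiveLength len)
  (hne : ∀ a, of R a ≠ 1)
include hc hlen hne

theorem headsFactor_of_conGen {n : ℕ}
    (hatom : ∀ a b, IsLcmSquareOn {x | len x ≤ n} (of R a) (of R b) (c a b) (c b a))
    (hcube : ∀ d a b, CubeAt (of R) c d a b) {u v : FreeMonoid A} (h : ConGen.Rel R u v)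
    (hu : len (PresentedMonoid.mk R u) ≤ n + 1) : HeadsFactor c u v := by
  induction h with
  | of u v h => exact hc.headsFactor h
  | refl u => exact .refl hc.self u
  | symm h ih => exact (ih (mk_eq_mk_iff.2 h ▸ hu)).symm
  | trans h _ ih ih' =>
    have hv := mk_eq_mk_iff.2 h ▸ hu
    refine (ih hu).trans (hlen.mem_le_of_mul_mem_le n) hatom hcube (fun d x hx => ?_) (ih' hv)
    have hpos : 0 < len (PresentedMonoid.mk R (.of d)) := hlen.pos (hne d)
    rw [hx, map_mul, hlen.map_mul] at hv
    rw [Set.mem_ofPred_eq]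
    omega
  | mul _ h' ih ih' =>
    rw [map_mul, hlen.map_mul] at hu
    exact (ih (by omega)).mul (ih' (by omega)) (mk_eq_mk_iff.2 h')

theorem isLcmSquareOn (hcube : ∀ d a b, CubeAt (of R) c d a b) (a b : A) :
    IsLcmSquareOn Set.univ (of R a) (of R b) (c a b) (c b a) := by
  have hle (n : ℕ) (a b : A) :
      IsLcmSquareOn {x | len x ≤ n} (of R a) (of R b) (c a b) (c b a) := by
    induction n generalizing a b with
    | zero =>
      refine ⟨hc.mul_eq a b, fun {x y} _ h => absurd (hlen.pos (hne a)) ?_⟩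
      have hmul := hlen.map_mul (of R a) x
      simp only [Set.mem_ofPred_eq] at h
      omega
    | succ n ih =>
      refine ⟨hc.mul_eq a b, fun {x y} hxy h => ?_⟩
      induction x using PresentedMonoid.inductionOn with | _ x
      induction y using PresentedMonoid.inductionOn with | _ y
      exact (hc.headsFactor_of_conGen hlen hne ih hcube (mk_eq_mk_iff.1 hxy) h).exists_of_of_mul
  exact ⟨hc.mul_eq a b, fun {x _} h _ =>
    (hle (len (of R a * x)) a b).exists_factor h (le_refl (len (of R a * x)))⟩

end IsComplement

end Complement

/-! ### The presentation of `B⊕(e, e, r)` -/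

variable {e r : ℕ}

namespace Gen

/-- The height of a generator: `2` for `t_i`, and `j` for `s_j`. -/
def ht : Gen e r → ℕ
  | t _ => 2
  | s j => j

/-- The permutation `t_i ↦ t_{i-1}`, `s_j ↦ s_j` of the generators. -/
def pred : Gen e r → Gen e r
  | t i => t (i - 1)
  | s j => s j

/-- The involution `t_i ↦ t_{-i}`, `s_j ↦ s_j` of the generators. -/
def neg : Gen e r → Gen e r
  | t i => t (-i)
  | s j => s j

/-- Generators whose heights differ by at least two. -/
def Far (a b : Gen e r) : Prop := a.ht + 2 ≤ b.ht ∨ b.ht + 2 ≤ a.ht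

/-- Generators of consecutive heights. -/
def Near (a b : Gen e r) : Prop := a.ht + 1 = b.ht ∨ b.ht + 1 = a.ht

/-- Distinct generators of the same height; both are then among the `t_i`. -/
def Twin (a b : Gen e r) : Prop := a ≠ b ∧ a.ht = b.ht

variable {a b d : Gen e r}

@[simp] theorem ht_pred (a : Gen e r) : a.pred.ht = a.ht := by cases a <;> rfl

@[simp] theorem ht_neg (a : Gen e r) : a.neg.ht = a.ht := by cases a <;> rfl

@[simp] theorem neg_neg (a : Gen e r) : a.neg.neg = a := by cases a <;> simp [neg]

theorem pred_neg_pred (a : Gen e r) : a.pred.neg.pred = a.neg := by cases a <;> simp [pred, neg]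

theorem pred_injective : Function.Injective (pred : Gen e r → Gen e r) := by
  rintro (i | i) (j | j) h <;> simp_all [pred]

theorem pred_surjective : Function.Surjective (pred : Gen e r → Gen e r) :=
  fun a => ⟨a.neg.pred.neg, by rw [pred_neg_pred, neg_neg]⟩

theorem two_le_ht : ∀ a : Gen e r, 2 ≤ a.ht
  | t _ => le_rfl
  | s j => (Nat.le_succ 2).trans j.2.1

theorem two_lt_ht_s (j : Set.Icc 3 r) : 2 < (s j : Gen e r).ht := j.2.1

theorem ht_le (hr : 2 ≤ r) : ∀ a : Gen e r, a.ht ≤ r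
  | t _ => hr
  | s j => j.2.2

theorem eq_s_of_ht {k : ℕ} (h3 : 3 ≤ k) (hk : k ≤ r) :
    ∀ {a : Gen e r}, a.ht = k → a = s ⟨k, h3, hk⟩
  | t _, h => by simp only [ht] at h; omega
  | s _, h => congrArg s (Subtype.ext h)

theorem eq_of_ht_eq (ha : 3 ≤ a.ht) (h : a.ht = b.ht) : a = b := by
  cases a with
  | t i => simp only [ht] at ha; omega
  | s j => exact (eq_s_of_ht j.2.1 j.2.2 h.symm).symm

theorem finite (he : 1 ≤ e) : Finite (Gen e r) := by
  have : NeZero e := ⟨Nat.one_le_iff_ne_zero.1 he⟩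
  refine Finite.of_surjective (Sum.elim t s) fun a => ?_
  cases a with
  | t i => exact ⟨.inl i, rfl⟩
  | s j => exact ⟨.inr j, rfl⟩

theorem exists_ht_eq {k : ℕ} (h3 : 3 ≤ k) (hk : k ≤ r) : ∃ a : Gen e r, a.ht = k :=
  ⟨s ⟨k, h3, hk⟩, rfl⟩

theorem ht_iterate_pred (n : ℕ) (a : Gen e r) : (pred^[n] a).ht = a.ht := by
  induction n with
  | zero => rfl
  | succ n ih => rw [Function.iterate_succ_apply', ht_pred, ih]

theorem pred_eq_self (ha : 3 ≤ a.ht) : a.pred = a := (eq_of_ht_eq ha a.ht_pred.symm).symm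

theorem Far.symm (h : Far a b) : Far b a := Or.symm h

theorem Near.symm (h : Near a b) : Near b a := Or.symm h

theorem Near.congr_right (h : Near a b) (hbd : b.ht = d.ht) : Near a d := by
  unfold Near at h ⊢
  omega

theorem Near.pred_right (h : Near a b) : Near a b.pred := h.congr_right b.ht_pred.symm

theorem Far.congr_right (h : Far a b) (hbd : b.ht = d.ht) : Far a d := by
  unfold Far at h ⊢
  omega

theorem Far.pred_right (h : Far a b) : Far a b.pred := h.congr_right b.ht_pred.symm

theorem Twin.symm (h : Twin a b) : Twin b a := ⟨h.1.symm, h.2.symm⟩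

theorem Twin.pred (h : Twin a b) : Twin a.pred b.pred :=
  ⟨pred_injective.ne h.1, by simpa using h.2⟩

theorem Twin.pred_self (h : Twin a b) : Twin a.pred a := by
  refine ⟨?_, a.ht_pred⟩
  rcases a with i | i <;> rcases b with j | j
  · intro hi
    have h10 : (1 : ZMod e) = 0 := by simpa [Gen.pred] using hi
    have := subsingleton_of_zero_eq_one h10.symm
    exact h.1 (congrArg t (Subsingleton.elim i j))
  · exact absurd h.2 (two_lt_ht_s j).ne
  · exact absurd h.2 (two_lt_ht_s i).ne'
  · exact absurd (eq_of_ht_eq (two_lt_ht_s i) h.2) h.1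

theorem eq_or_twin_or_near_or_far (a b : Gen e r) : a = b ∨ Twin a b ∨ Near a b ∨ Far a b := by
  unfold Twin Near Far
  by_cases h : a = b
  · exact .inl h
  · simp only [h, ne_eq, not_false_eq_true, true_and, false_or]
    omega

end Gen

open Gen

theorem Rel.cases_ht {u v : FreeMonoid (Gen e r)} (h : Rel e r u v) : ∃ a b : Gen e r,
    (Near a b ∧ u = .of a * .of b * .of a ∧ v = .of b * .of a * .of b) ∨
    (Far a b ∧ u = .of a * .of b ∧ v = .of b * .of a) ∨
    (a.ht = b.ht ∧ u = .of a * .of a.pred ∧ v = .of b * .of b.pred) := by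
  cases h with
  | R1 i j h =>
    refine ⟨.s i, .s j, .inl ⟨?_, rfl, rfl⟩⟩
    rw [abs_eq zero_le_one] at h
    simp only [Near, ht]
    omega
  | R2 i j h =>
    refine ⟨.s i, .s j, .inr (.inl ⟨?_, rfl, rfl⟩)⟩
    rw [lt_abs] at h
    simp only [Far, ht]
    omega
  | R3 j h i => exact ⟨.s j, .t i, .inl ⟨.inr h.symm, rfl, rfl⟩⟩
  | R4 j h i => exact ⟨.s j, .t i, .inr (.inl ⟨.inr h, rfl, rfl⟩)⟩
  | R5 i j => exact ⟨.t i, .t j, .inr (.inr ⟨rfl, rfl, rfl⟩)⟩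

/-- A generator, as an element of the monoid. -/
abbrev gen (a : Gen e r) : BraidMonoid e r := PresentedMonoid.of (Rel e r) a

section Relations

open PresentedMonoid (mk_eq_mk_of_rel)

variable {a b : Gen e r}

theorem gen_far (h : Far a b) : gen a * gen b = gen b * gen a := by
  rcases a with i | i <;> rcases b with j | j <;> simp only [Far, ht] at h
  · omega
  · have hj : 4 ≤ (j : ℕ) := by have := j.2.1; omega
    exact (mk_eq_mk_of_rel (.R4 j hj i)).symm
  · have hi : 4 ≤ (i : ℕ) := by have := i.2.1; omega
    exact mk_eq_mk_of_rel (.R4 i hi j)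
  · exact mk_eq_mk_of_rel (.R2 i j (by rw [lt_abs]; omega))

theorem gen_near (h : Near a b) : gen a * gen b * gen a = gen b * gen a * gen b := by
  rcases a with i | i <;> rcases b with j | j <;> simp only [Near, ht] at h
  · omega
  · have hj : (j : ℕ) = 3 := by have := j.2.1; omega
    exact (mk_eq_mk_of_rel (.R3 j hj i)).symm
  · have hi : (i : ℕ) = 3 := by have := i.2.1; omega
    exact mk_eq_mk_of_rel (.R3 i hi j)
  · exact mk_eq_mk_of_rel (.R1 i j (by rw [abs_eq zero_le_one]; omega))

theorem gen_same (h : a.ht = b.ht) : gen a * gen a.pred = gen b * gen b.pred := by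
  rcases a with i | i <;> rcases b with j | j
  · exact mk_eq_mk_of_rel (.R5 i j)
  · exact absurd h (two_lt_ht_s j).ne
  · exact absurd h (two_lt_ht_s i).ne'
  · rw [eq_of_ht_eq (two_lt_ht_s i) h]

theorem gen_far_assoc (h : Far a b) (x : BraidMonoid e r) :
    gen a * (gen b * x) = gen b * (gen a * x) := by
  simp only [← mul_assoc, gen_far h]

theorem gen_near' (h : Near a b) : gen a * (gen b * gen a) = gen b * (gen a * gen b) := by
  simp only [← mul_assoc, gen_near h]

theorem gen_near_assoc (h : Near a b) (x : BraidMonoid e r) :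
    gen a * (gen b * (gen a * x)) = gen b * (gen a * (gen b * x)) := by
  simp only [← mul_assoc, gen_near h]

theorem gen_same_assoc (h : a.ht = b.ht) (x : BraidMonoid e r) :
    gen a * (gen a.pred * x) = gen b * (gen b.pred * x) := by
  simp only [← mul_assoc, gen_same h]

theorem closure_range_gen : Submonoid.closure (Set.range (gen : Gen e r → BraidMonoid e r)) = ⊤ :=
  PresentedMonoid.closure_range_of _

end Relations

/-- The word length, as a homomorphism. -/
def lenHom (e r : ℕ) : BraidMonoid e r →* Multiplicative ℕ :=
  PresentedMonoid.lift (fun _ => Multiplicative.ofAdd 1) fun _ _ h => by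
    cases h <;> simp only [map_mul, FreeMonoid.lift_eval_of]

/-- The word length of an element. -/
def len (x : BraidMonoid e r) : ℕ := (lenHom e r x).toAdd

@[simp] theorem len_gen (a : Gen e r) : len (gen a) = 1 := rfl

theorem isAdditiveLength_len : IsAdditiveLength (len : BraidMonoid e r → ℕ) where
  map_mul x y := by rw [len, map_mul]; rfl
  eq_one_of_eq_zero {x} h := by
    induction x using PresentedMonoid.inductionOn with | _ w
    cases w using FreeMonoid.casesOn with
    | one => rfl
    | of_mul a w =>
      rw [map_mul, len, map_mul] at h
      exact absurd (Nat.add_eq_zero_iff.1 h).1 one_ne_zero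

theorem gen_ne_one (a : Gen e r) : gen a ≠ 1 := fun h => by
  have h0 := isAdditiveLength_len.map_one ▸ h ▸ len_gen a
  exact zero_ne_one h0

/-- The anti-automorphism `t_i ↦ t_{-i}`, `s_j ↦ s_j`, as a homomorphism to the opposite monoid. -/
def reverseHom (e r : ℕ) : BraidMonoid e r →* (BraidMonoid e r)ᵐᵒᵖ :=
  PresentedMonoid.lift (fun a => .op (gen a.neg)) fun _ _ h => by
    obtain ⟨a, b, ⟨hab, rfl, rfl⟩ | ⟨hab, rfl, rfl⟩ | ⟨hab, rfl, rfl⟩⟩ := h.cases_ht <;>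
      simp only [map_mul, FreeMonoid.lift_eval_of, ← MulOpposite.op_mul]
    · have hneg : Near a.neg b.neg := by simpa only [Near, ht_neg] using hab
      rw [gen_near' hneg]
    · have hneg : Far b.neg a.neg := by simpa only [Far, ht_neg] using hab.symm
      rw [gen_far hneg]
    · have hneg : a.pred.neg.ht = b.pred.neg.ht := by simpa only [ht_neg, ht_pred] using hab
      rw [← pred_neg_pred a, ← pred_neg_pred b, gen_same hneg]

/-- The `star` of the monoid is the anti-automorphism `t_i ↦ t_{-i}`, `s_j ↦ s_j`. -/
instance : StarMul (BraidMonoid e r) where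
  star x := (reverseHom e r x).unop
  star_mul x y := by rw [map_mul, MulOpposite.unop_mul]
  star_involutive x := by
    change (reverseHom e r (reverseHom e r x).unop).unop = x
    induction x using Submonoid.induction_of_closure_eq_top_left closure_range_gen with
    | one => simp only [map_one, MulOpposite.unop_one]
    | mul_left _ ha y ih =>
      obtain ⟨a, rfl⟩ := ha
      rw [map_mul, MulOpposite.unop_mul, map_mul, MulOpposite.unop_mul, ih]
      exact congrArg (gen · * y) a.neg_neg

theorem star_gen (a : Gen e r) : star (gen a) = gen a.neg := rfl

section Complement

variable {a b d : Gen e r}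

open Classical in
/-- The right complement of `a` in `b`: `gen a * complement a b` is the right lcm of `a`, `b`. -/
noncomputable def complement (a b : Gen e r) : BraidMonoid e r :=
  if a = b then 1
  else if a.ht = b.ht then gen a.pred
  else if Near a b then gen b * gen a
  else gen b

theorem complement_self (a : Gen e r) : complement a a = 1 := if_pos rfl

theorem complement_of_twin (h : Twin a b) : complement a b = gen a.pred := by
  rw [complement, if_neg h.1, if_pos h.2]

theorem complement_of_near (h : Near a b) : complement a b = gen b * gen a := by
  have hht : a.ht ≠ b.ht := by unfold Near at h; omega
  rw [complement, if_neg (mt (congrArg ht) hht), if_neg hht, if_pos h]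

theorem complement_of_far (h : Far a b) : complement a b = gen b := by
  have hht : a.ht ≠ b.ht ∧ ¬ Near a b := by unfold Far at h; unfold Near; omega
  rw [complement, if_neg (mt (congrArg ht) hht.1), if_neg hht.1, if_neg hht.2]

theorem gen_mul_complement (a b : Gen e r) :
    gen a * complement a b = gen b * complement b a := by
  obtain rfl | h | h | h := eq_or_twin_or_near_or_far a b
  · rfl
  · rw [complement_of_twin h, complement_of_twin h.symm, gen_same h.2]
  · rw [complement_of_near h, complement_of_near h.symm, gen_near' h]
  · rw [complement_of_far h, complement_of_far h.symm, gen_far h]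

theorem isComplement_complement : IsComplement (complement : Gen e r → Gen e r → _) where
  self := complement_self
  mul_eq := gen_mul_complement
  headsFactor h := by
    obtain ⟨a, b, ⟨hab, rfl, rfl⟩ | ⟨hab, rfl, rfl⟩ | ⟨hab, rfl, rfl⟩⟩ := h.cases_ht
    · rw [mul_assoc, mul_assoc]
      refine .of_mul (z := 1) ?_ ?_
      · rw [complement_of_near hab, mul_one, map_mul]; rfl
      · rw [complement_of_near hab.symm, mul_one, map_mul]; rfl
    · refine .of_mul (z := 1) ?_ ?_
      · rw [complement_of_far hab, mul_one]; rfl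
      · rw [complement_of_far hab.symm, mul_one]; rfl
    · obtain rfl | hne := eq_or_ne a b
      · exact .refl complement_self _
      refine .of_mul (z := 1) ?_ ?_
      · rw [complement_of_twin ⟨hne, hab⟩, mul_one]; rfl
      · rw [complement_of_twin ⟨hne.symm, hab.symm⟩, mul_one]; rfl

/-- Pasted lcm squares of the monoid. -/
abbrev Grid (u v p q : BraidMonoid e r) : Prop := LcmGrid gen complement u v p q

theorem grid_self (u : BraidMonoid e r) : Grid u u 1 1 := .self closure_range_gen complement_self u

theorem grid_twin (h : Twin a b) : Grid (gen a) (gen b) (gen a.pred) (gen b.pred) := by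
  rw [← complement_of_twin h, ← complement_of_twin h.symm]
  exact .atom a b

theorem grid_near (h : Near a b) : Grid (gen a) (gen b) (gen b * gen a) (gen a * gen b) := by
  rw [← complement_of_near h, ← complement_of_near h.symm]
  exact .atom a b

theorem grid_far (h : Far a b) : Grid (gen a) (gen b) (gen b) (gen a) := by
  have hatom : Grid (gen a) (gen b) (complement a b) (complement b a) := .atom a b
  rwa [complement_of_far h, complement_of_far h.symm] at hatom

theorem grid_near_mul_self (h : Near a b) :
    Grid (gen a) (gen b * gen a) (gen b * gen a) (gen b) := by
  simpa only [mul_one, one_mul] using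
    (grid_near h).mul_right ((grid_self (gen a)).mul_left (.one_right (gen b)))

theorem grid_complement_of_far (had : Far a d) (hab : Far a b) :
    Grid (gen a) (complement d b) (complement d b) (gen a) := by
  obtain rfl | h | h | h := eq_or_twin_or_near_or_far d b
  · rw [complement_self]
    exact .one_right _
  · rw [complement_of_twin h]
    exact grid_far had.pred_right
  · rw [complement_of_near h]
    exact (grid_far hab).mul_right (grid_far had)
  · rw [complement_of_far h]
    exact grid_far hab

end Complement

section Cube

variable {a b d : Gen e r}

/-- The cube condition of `B⊕(e, e, r)`. -/
abbrev Cube (d a b : Gen e r) : Prop := CubeAt gen complement d a b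

theorem cube_of_far_of_far (had : Far a d) (hbd : Far b d) : Cube d a b := by
  refine ⟨complement a b, complement b a, gen d, ?_, ?_, ?_⟩
  · rw [complement_of_far had.symm, complement_of_far hbd.symm]
    exact .atom a b
  · rw [complement_of_far had]
    exact (grid_complement_of_far had.symm hbd.symm).mul_eq gen_mul_complement
  · rw [complement_of_far hbd]
    exact (grid_complement_of_far hbd.symm had.symm).mul_eq gen_mul_complement

theorem cube_of_far_left (had : Far a d) (hab : Far a b) : Cube d a b := by
  refine ⟨complement d b, gen a, complement b d, ?_, ?_, ?_⟩
  · rw [complement_of_far had.symm]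
    exact grid_complement_of_far had hab
  · rw [complement_of_far had, complement_of_far hab, gen_mul_complement]
  · rw [complement_of_far hab.symm]
    exact ((grid_complement_of_far hab had).mul_eq gen_mul_complement).symm

theorem cube_of_twin (hda : Twin d a) (hdb : Twin d b) (hab : Twin a b) : Cube d a b := by
  refine ⟨1, 1, 1, ?_, ?_, ?_⟩
  · rw [complement_of_twin hda, complement_of_twin hdb]
    exact grid_self _
  · rw [complement_of_twin hda.symm, complement_of_twin hab]
  · rw [complement_of_twin hdb.symm, complement_of_twin hab.symm]

theorem cube_of_twin_of_near (had : Twin a d) (hbd : Near b d) : Cube d a b := by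
  have hba : Near b a := hbd.congr_right had.2.symm
  have hda : d.pred.ht = a.pred.ht := had.pred.2.symm
  refine ⟨gen b * (gen d.pred * (gen d.pred.pred * gen b)), gen d.pred * (gen b * gen d.pred.pred),
    gen a.pred * (gen b * gen a.pred.pred), ?_, ?_, ?_⟩
  · rw [complement_of_twin had.symm, complement_of_near hbd.symm]
    have hgrid := (grid_near hbd.pred_right.symm).mul_right
      ((grid_twin had.symm.pred_self).mul_left (grid_near hbd.pred_right.pred_right))
    simpa only [mul_assoc] using hgrid
  · rw [complement_of_twin had, complement_of_near hba.symm]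
    simp only [mul_assoc]
    rw [gen_same_assoc hda, gen_near_assoc hba.pred_right.symm, gen_near' hba.pred_right.pred_right,
      gen_same_assoc a.ht_pred]
  · rw [complement_of_near hbd, complement_of_near hba]
    simp only [mul_assoc]
    rw [gen_near_assoc hbd.pred_right, gen_same hda, gen_same_assoc had.2.symm,
      gen_near_assoc hba.pred_right]

theorem cube_of_near_of_near_of_twin (had : Near a d) (hbd : Near b d) (hab : Twin a b) :
    Cube d a b := by
  have hda' : Near d a.pred := had.symm.pred_right
  have hdb' : Near d b.pred := hbd.symm.pred_right
  refine ⟨gen a.pred * (gen d * gen a.pred.pred), gen b.pred * (gen d * gen b.pred.pred),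
    gen d * (gen a.pred * (gen a.pred.pred * gen d)), ?_, ?_, ?_⟩
  · rw [complement_of_near had.symm, complement_of_near hbd.symm]
    have ha := (grid_twin hab).mul_right (grid_near hdb'.symm)
    have hd := (grid_near_mul_self hda').mul_right (grid_twin hab.pred)
    simpa only [mul_assoc] using ha.mul_left (by simpa only [mul_assoc] using hd)
  · rw [complement_of_near had, complement_of_twin hab]
    simp only [mul_assoc]
    rw [gen_same_assoc a.ht_pred.symm, gen_near' hda'.pred_right.symm, gen_near_assoc hda']
  · rw [complement_of_near hbd, complement_of_twin hab.symm]
    simp only [mul_assoc]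
    rw [gen_same_assoc b.ht_pred.symm, gen_near' hdb'.pred_right.symm, gen_near_assoc hdb',
      gen_same_assoc hab.pred.2]

theorem cube_of_near_of_near_of_far (had : Near a d) (hbd : Near b d) (hab : Far a b) :
    Cube d a b := by
  refine ⟨gen b * (gen d * gen a), gen a * (gen d * gen b),
    gen d * (gen b * (gen a * gen d)), ?_, ?_, ?_⟩
  · rw [complement_of_near had.symm, complement_of_near hbd.symm]
    have ha := (grid_far hab).mul_right (grid_near had)
    have hd := (grid_near_mul_self hbd.symm).mul_right (grid_far hab.symm)
    simpa only [mul_assoc] using ha.mul_left (by simpa only [mul_assoc] using hd)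
  · rw [complement_of_near had, complement_of_far hab]
    simp only [mul_assoc]
    rw [gen_far_assoc hab, gen_near' had, gen_near_assoc hbd]
  · rw [complement_of_near hbd, complement_of_far hab.symm]
    simp only [mul_assoc]
    rw [gen_far_assoc hab.symm, gen_near' hbd, gen_near_assoc had.symm, gen_far_assoc hab]

theorem cube_of_near_of_far_of_near (had : Near a d) (hbd : Far b d) (hab : Near a b) :
    Cube d a b := by
  refine ⟨gen b * (gen a * gen d), gen a * (gen b * (gen d * gen a)),
    gen d * (gen a * gen b), ?_, ?_, ?_⟩
  · rw [complement_of_near had.symm, complement_of_far hbd.symm]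
    have hd := (grid_far hbd.symm).mul_right (grid_near had.symm)
    simpa only [mul_assoc] using (grid_near hab).mul_left hd
  · rw [complement_of_near had, complement_of_near hab]
    simp only [mul_assoc]
    rw [gen_near_assoc hab, gen_far hbd, gen_far_assoc hbd.symm, gen_near_assoc had.symm]
  · rw [complement_of_far hbd, complement_of_near hab.symm]
    simp only [mul_assoc]
    rw [gen_far_assoc hbd, gen_near_assoc had.symm, gen_near' hab, gen_far_assoc hbd.symm]

theorem cube_of_near_of_near (had : Near a d) (hbd : Near b d) (hab : a ≠ b) : Cube d a b := by
  obtain hab | hab | hab := (eq_or_twin_or_near_or_far a b).resolve_left hab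
  · exact cube_of_near_of_near_of_twin had hbd hab
  · unfold Near at had hbd hab
    omega
  · exact cube_of_near_of_near_of_far had hbd hab

theorem cube_of_near_of_far (had : Near a d) (hbd : Far b d) (hab : a ≠ b) : Cube d a b := by
  obtain hab | hab | hab := (eq_or_twin_or_near_or_far a b).resolve_left hab
  · have hht := hab.2
    unfold Near at had
    unfold Far at hbd
    omega
  · exact cube_of_near_of_far_of_near had hbd hab
  · exact (cube_of_far_left hbd hab.symm).symm

theorem cube (d a b : Gen e r) : Cube d a b := by
  refine CubeAt.of_ne closure_range_gen complement_self (fun d a b had hbd hab => ?_) d a b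
  obtain had | had | had := (eq_or_twin_or_near_or_far a d).resolve_left had <;>
    obtain hbd | hbd | hbd := (eq_or_twin_or_near_or_far b d).resolve_left hbd
  · exact cube_of_twin had.symm hbd.symm ⟨hab, had.2.trans hbd.2.symm⟩
  · exact cube_of_twin_of_near had hbd
  · exact (cube_of_far_left hbd (hbd.congr_right had.2.symm)).symm
  · exact (cube_of_twin_of_near hbd had).symm
  · exact cube_of_near_of_near had hbd hab
  · exact cube_of_near_of_far had hbd hab
  · exact cube_of_far_left had (had.congr_right hbd.2.symm)
  · exact (cube_of_near_of_far hbd had hab.symm).symm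
  · exact cube_of_far_of_far had hbd

end Cube

theorem isLcmSquareOn_complement (a b : Gen e r) :
    IsLcmSquareOn Set.univ (gen a) (gen b) (complement a b) (complement b a) :=
  isComplement_complement.isLcmSquareOn isAdditiveLength_len gen_ne_one cube a b

instance : IsLeftCancelMul (BraidMonoid e r) :=
  isLeftCancelMul_of_isLcmSquareOn closure_range_gen fun a => by
    simpa only [complement_self] using isLcmSquareOn_complement a a

theorem Grid.isLcmSquareOn {u v p q : BraidMonoid e r} (h : Grid u v p q) :
    IsLcmSquareOn Set.univ u v p q :=
  LcmGrid.isLcmSquareOn (fun _ _ _ => trivial) isLcmSquareOn_complement h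

theorem exists_isRightLcm {x y u v : BraidMonoid e r} (h : x * u = y * v) :
    ∃ m, IsRightLcm {x, y} m := by
  obtain ⟨p, q, hpq⟩ :=
    isAdditiveLength_len.exists_lcmGrid closure_range_gen isLcmSquareOn_complement h
  exact ⟨x * p, (Grid.isLcmSquareOn hpq).isRightLcm⟩

/-! ### The Garside element `Δ` -/

section Lambda

variable {a b : Gen e r} {i j k : ℕ}

theorem tau_eq (h : a.ht = 2) : tau e r = gen a * gen a.pred := by
  rw [gen_same (b := .t 1) h, pred, sub_self]
  rfl

theorem lam_succ (hk : k + 1 + 2 ≤ r) (hb : b.ht = k + 3) :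
    Lam e r (k + 1) hk = gen b * Lam e r k (Nat.le_of_succ_le hk) * gen b := by
  rw [eq_s_of_ht (by omega) hk hb]
  rfl

theorem grid_lam_of_far (hk : k + 2 ≤ r) (hb : k + 4 ≤ b.ht) :
    Grid (Lam e r k hk) (gen b) (gen b) (Lam e r k hk) := by
  induction k with
  | zero => exact (grid_far (a := .t 1) (.inl hb)).mul_left (grid_far (a := .t 0) (.inl hb))
  | succ k ih =>
    obtain ⟨a, ha⟩ := exists_ht_eq (e := e) (by omega) hk
    have hab := grid_far (a := a) (b := b) (.inl (by omega))
    rw [lam_succ hk ha]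
    exact (hab.mul_left (ih _ (by omega))).mul_left hab

/-- Both `Λ_2 = t_i · 1 · t_{i-1}` and `Λ_p = s_p · Λ_{p-1} · s_p` have the shape `a L a.pred`, with
`L` commuting with the generators above `a`. -/
theorem exists_lam_eq (hk : k + 2 ≤ r) (ha : a.ht = k + 2) : ∃ L : BraidMonoid e r,
    Lam e r k hk = gen a * L * gen a.pred ∧ ∀ b : Gen e r, a.ht < b.ht → Commute (gen b) L := by
  cases k with
  | zero =>
    refine ⟨1, ?_, fun _ _ => Commute.one_right _⟩
    rw [mul_one]
    exact tau_eq ha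
  | succ k =>
    refine ⟨Lam e r k (by omega), ?_, fun b hb => ?_⟩
    · rw [lam_succ hk ha, pred_eq_self (by omega)]
    · exact ((grid_lam_of_far (by omega) (by omega)).mul_eq gen_mul_complement).symm

theorem semiconjBy_lam (hk : k + 2 ≤ r) (ha : a.ht < k + 2) :
    SemiconjBy (Lam e r k hk) (gen a.pred) (gen a) := by
  induction k with
  | zero => exact absurd a.two_le_ht ha.not_ge
  | succ k ih =>
    obtain ⟨b, hb⟩ := exists_ht_eq (e := e) (by omega) hk
    rw [lam_succ hk hb]
    obtain hlt | heq : a.ht < k + 2 ∨ a.ht = k + 2 := by omega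
    · have hba : Far b a := .inr (by omega)
      exact (SemiconjBy.mul_left (gen_far hba) (ih _ hlt)).mul_left (gen_far hba.pred_right)
    · have hab : Near a b := .inl (by omega)
      obtain ⟨L, hL, hcomm⟩ := exists_lam_eq (by omega) heq
      have hbL : gen b * L = L * gen b := hcomm b (by omega)
      calc gen b * Lam e r k (by omega) * gen b * gen a.pred
          = gen b * gen a * L * (gen a.pred * gen b * gen a.pred) := by
            simp only [hL, gen_near hab.symm.pred_right.symm, mul_assoc]
        _ = gen b * gen a * (L * gen b) * gen a.pred * gen b := by
            simp only [gen_near hab.symm.pred_right.symm, mul_assoc]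
        _ = gen a * gen b * gen a * L * gen a.pred * gen b := by
            rw [gen_near hab, ← hbL]
            simp only [mul_assoc]
        _ = gen a * (gen b * Lam e r k (by omega) * gen b) := by
            simp only [hL, mul_assoc]

theorem commute_tau_lam (hk : k + 1 + 2 ≤ r) : Commute (tau e r) (Lam e r (k + 1) hk) := by
  have ht (a : Gen e r) (ha : a.ht = 2) := semiconjBy_lam hk (a := a) (by omega)
  have h0 : (Gen.t 0 : Gen e r).ht = 2 := rfl
  have hmul := (ht (.t 0) h0).mul_right (ht (Gen.t 0).pred h0)
  rw [← tau_eq h0, ← tau_eq (a := (Gen.t 0).pred) h0] at hmul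
  exact hmul.symm

theorem commute_lam_lam (hj : j + 2 ≤ r) (hij : i < j) :
    Commute (Lam e r i (by omega)) (Lam e r j hj) := by
  induction i with
  | zero =>
    obtain ⟨j, rfl⟩ := Nat.exists_eq_succ_of_ne_zero hij.ne'
    exact commute_tau_lam hj
  | succ i ih =>
    obtain ⟨b, hb⟩ := exists_ht_eq (e := e) (r := r) (k := i + 3) (by omega) (by omega)
    have hbj := semiconjBy_lam hj (a := b) (by omega)
    rw [pred_eq_self (by omega)] at hbj
    rw [lam_succ (by omega) hb]
    exact ((Commute.symm hbj).mul_left (ih (by omega))).mul_left (Commute.symm hbj)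

end Lambda

section LambdaProduct

variable {a b : Gen e r} {n : ℕ}

/-- The partial product `Λ_2 ⋯ Λ_{n+1}` of `Δ`. -/
def lamProd (e r n : ℕ) (hn : n + 1 ≤ r) : BraidMonoid e r :=
  (List.ofFn fun k : Fin n => Lam e r k (by omega)).prod

theorem lamProd_zero (hn : 0 + 1 ≤ r) : lamProd e r 0 hn = 1 := rfl

theorem lamProd_succ (hn : n + 1 + 1 ≤ r) :
    lamProd e r (n + 1) hn = lamProd e r n (by omega) * Lam e r n hn := by
  rw [lamProd, List.ofFn_succ', List.concat_eq_append, List.prod_append, List.prod_singleton]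
  rfl

theorem lamProd_one (hn : 0 + 1 + 1 ≤ r) : lamProd e r (0 + 1) hn = tau e r := by
  rw [lamProd_succ, lamProd_zero, one_mul, Lam]

theorem grid_lamProd_of_far (hn : n + 1 ≤ r) (hb : n + 3 ≤ b.ht) :
    Grid (lamProd e r n hn) (gen b) (gen b) (lamProd e r n hn) := by
  induction n with
  | zero => exact .one_left _
  | succ n ih =>
    rw [lamProd_succ]
    exact (ih _ (by omega)).mul_left (grid_lam_of_far _ (by omega))

theorem commute_lamProd_of_far (hn : n + 1 ≤ r) (hb : n + 3 ≤ b.ht) :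
    Commute (lamProd e r n hn) (gen b) :=
  (grid_lamProd_of_far hn hb).mul_eq gen_mul_complement

theorem exists_lamProd_eq (hn : n + 1 + 1 ≤ r) (ha : a.ht = n + 2) : ∃ w : BraidMonoid e r,
    lamProd e r (n + 1) hn = gen a * w ∧
    lamProd e r (n + 1) hn = w * gen (pred^[n + 2] a) := by
  cases n with
  | zero =>
    refine ⟨gen a.pred, ?_, ?_⟩ <;> rw [lamProd_one]
    · exact tau_eq ha
    · exact tau_eq (a.ht_pred.trans ha)
  | succ n =>
    have hlam := (commute_lam_lam (e := e) hn (Nat.lt_succ_self n)).eq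
    have hfar := (commute_lamProd_of_far (e := e) (b := a) (n := n) (by omega) ha.ge).eq
    refine ⟨lamProd e r (n + 1) (by omega) * gen a * Lam e r n (by omega), ?_, ?_⟩
    · rw [lamProd_succ, lamProd_succ, mul_assoc, hlam, lam_succ hn ha]
      simp only [← mul_assoc, hfar]
    · rw [Function.iterate_fixed (pred_eq_self (by omega)), lamProd_succ, lam_succ hn ha]
      simp only [mul_assoc]

theorem gen_dvd_lamProd (hn : n + 1 ≤ r) (ha : a.ht ≤ n + 1) : gen a ∣ lamProd e r n hn := by
  induction n with
  | zero => exact absurd a.two_le_ht (by omega)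
  | succ n ih =>
    obtain hlt | heq : a.ht ≤ n + 1 ∨ a.ht = n + 2 := by omega
    · rw [lamProd_succ]
      exact (ih _ hlt).mul_right _
    · obtain ⟨w, hw, -⟩ := exists_lamProd_eq hn heq
      exact ⟨w, hw⟩

theorem semiconjBy_lamProd (hn : n + 1 ≤ r) (ha : a.ht ≤ n + 1) :
    SemiconjBy (lamProd e r n hn) (gen (pred^[n + 1] a)) (gen a) := by
  induction n with
  | zero => exact absurd a.two_le_ht (by omega)
  | succ n ih =>
    obtain hlt | heq : a.ht ≤ n + 1 ∨ a.ht = n + 2 := by omega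
    · have hlam : (pred^[n + 1] a).ht < n + 2 := by rw [ht_iterate_pred]; omega
      rw [lamProd_succ, Function.iterate_succ_apply']
      exact (ih _ hlt).mul_left (semiconjBy_lam hn hlam)
    · obtain ⟨w, hleft, hright⟩ := exists_lamProd_eq hn heq
      calc lamProd e r (n + 1) hn * gen (pred^[n + 2] a)
          = gen a * (w * gen (pred^[n + 2] a)) := by rw [hleft, mul_assoc]
        _ = gen a * lamProd e r (n + 1) hn := by rw [← hright]

end LambdaProduct

section Delta

theorem gen_dvd_delta (hr : 2 ≤ r) (a : Gen e r) : gen a ∣ Delta e r :=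
  gen_dvd_lamProd (n := r - 1) (by omega) (by have := a.ht_le hr; omega)

theorem semiconjBy_delta (hr : 2 ≤ r) (a : Gen e r) :
    SemiconjBy (Delta e r) (gen (pred^[r] a)) (gen a) := by
  obtain ⟨n, rfl⟩ := Nat.exists_eq_add_of_le' hr
  exact semiconjBy_lamProd (n := n + 1) le_rfl (a.ht_le hr)

instance : IsCancelMul (BraidMonoid e r) := isCancelMul_of_star

theorem isGarsideElement_delta (he : 1 ≤ e) (hr : 2 ≤ r) : IsGarsideElement (Delta e r) where
  balanced x := by
    refine dvd_iff_rightDvd_of_semiconjBy closure_range_gen ?_ ?_ x <;> rintro _ ⟨a, rfl⟩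
    · exact ⟨_, semiconjBy_delta hr a⟩
    · obtain ⟨b, rfl⟩ := pred_surjective.iterate r a
      exact ⟨_, semiconjBy_delta hr b⟩
  finite := by
    have := Gen.finite (r := r) he
    exact (isAdditiveLength_len.finite_setOf_le (Set.finite_range gen) closure_range_gen _).subset
      fun _ => isAdditiveLength_len.le_of_dvd
  generates := top_unique <| closure_range_gen.ge.trans <| Submonoid.closure_mono <|
    Set.range_subset_iff.2 <| gen_dvd_delta hr

theorem isGarsideMonoid (he : 1 ≤ e) (hr : 2 ≤ r) : IsGarsideMonoid (BraidMonoid e r) := by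
  have hΔ := isGarsideElement_delta he hr
  refine isAdditiveLength_len.isGarsideMonoid (fun x y => ?_) hΔ
  obtain ⟨u, v, huv⟩ := hΔ.exists_mul_eq_mul x y
  exact exists_isRightLcm huv

theorem IsGarsideElement.gen_dvd {g : BraidMonoid e r} (hg : IsGarsideElement g) (a : Gen e r) :
    gen a ∣ g :=
  mem_of_irreducible_of_closure_eq_top hg.generates isAdditiveLength_len.eq_one_of_isUnit
    (isAdditiveLength_len.irreducible_of_eq_one (len_gen a))

end Delta

section Lcm

variable {b : Gen e r} {n k : ℕ}

theorem twin_t_one_t_zero (he : 2 ≤ e) : Twin (.t 1 : Gen e r) (.t 0) := by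
  have : Fact (1 < e) := ⟨he⟩
  exact ⟨fun h => one_ne_zero (Gen.t.inj h), rfl⟩

theorem exists_grid_lam_succ (he : 2 ≤ e) (hk : k + 1 + 2 ≤ r) (hb : b.ht = k + 3) :
    ∃ q, Grid (Lam e r k (by omega)) (gen b) (Lam e r (k + 1) hk) q := by
  induction k generalizing b with
  | zero =>
    have hnear (i : ZMod e) : Near (.t i) b := .inl hb.symm
    have hlam : Lam e r (0 + 1) hk = gen b * gen (.t 0) * (gen (Gen.pred (.t 0)) * gen b) := by
      rw [lam_succ hk hb, Lam, tau_eq (a := .t 0) rfl]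
      simp only [mul_assoc]
    have htop := (grid_near (hnear 0)).mul_right
      ((grid_twin (twin_t_one_t_zero he).symm).mul_left (grid_near (hnear 0).symm.pred_right))
    rw [hlam]
    exact ⟨_, (grid_near (hnear 1)).mul_left htop⟩
  | succ k ih =>
    obtain ⟨a, ha⟩ := exists_ht_eq (e := e) (r := r) (k := k + 3) (by omega) (by omega)
    have hab : Near a b := .inl (by omega)
    have hfar : Grid (Lam e r k (by omega)) (gen b) (gen b) _ := grid_lam_of_far _ (by omega)
    obtain ⟨q, hq⟩ := ih (by omega) ha
    have hsucc := lam_succ (by omega) ha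
    have hlam : Lam e r (k + 1 + 1) hk =
        gen b * gen a * (Lam e r k (by omega) * (gen a * gen b)) := by
      rw [lam_succ hk hb, hsucc]
      simp only [mul_assoc]
    have hmul : gen b * Lam e r (k + 1) (by omega) =
        gen b * gen a * (Lam e r k (by omega) * gen a) := by
      rw [hsucc]
      simp only [mul_assoc]
    have htop := (grid_near_mul_self hab).mul_right (hfar.symm.mul_right (grid_near hab.symm))
    rw [← hmul, ← hlam] at htop
    rw [hsucc, mul_assoc]
    exact ⟨_, (grid_near hab).mul_left ((hfar.mul_right hq).mul_left htop)⟩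

theorem isRightLcm_lamProd_succ (he : 2 ≤ e) (hn : n + 2 + 1 ≤ r) (hb : b.ht = n + 3) :
    IsRightLcm {lamProd e r (n + 1) (by omega), gen b} (lamProd e r (n + 2) hn) := by
  obtain ⟨q, hq⟩ := exists_grid_lam_succ he hn hb
  have hgrid := (grid_lamProd_of_far (n := n) (by omega) hb.ge).mul_left hq
  rw [lamProd_succ hn, lamProd_succ]
  exact (Grid.isLcmSquareOn hgrid).isRightLcm

theorem isRightLcm_tau (he : 2 ≤ e) :
    IsRightLcm {gen (.t 1), gen (.t 0)} (tau e r) := by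
  rw [tau_eq (a := .t 1) rfl]
  exact (Grid.isLcmSquareOn (grid_twin (twin_t_one_t_zero he))).isRightLcm

theorem lamProd_dvd (he : 2 ≤ e) {m : BraidMonoid e r} (hm : ∀ a : Gen e r, gen a ∣ m)
    (hn : n + 1 ≤ r) : lamProd e r n hn ∣ m := by
  induction n with
  | zero => exact one_dvd m
  | succ n ih =>
    cases n with
    | zero =>
      rw [lamProd_one]
      refine (isRightLcm_tau he).2 m ?_
      rintro _ (rfl | rfl) <;> exact hm _
    | succ n =>
      obtain ⟨b, hb⟩ := exists_ht_eq (e := e) (by omega) hn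
      refine (isRightLcm_lamProd_succ he hn hb).2 m ?_
      rintro _ (rfl | rfl)
      exacts [ih _, hm b]

theorem delta_dvd (he : 2 ≤ e) (hr : 2 ≤ r) {m : BraidMonoid e r} (hm : ∀ a : Gen e r, gen a ∣ m) :
    Delta e r ∣ m :=
  lamProd_dvd (n := r - 1) he hm (by omega)

theorem isRightLcm_delta (he : 2 ≤ e) (hr : 2 ≤ r) : IsRightLcm (generators e r) (Delta e r) :=
  ⟨Set.forall_mem_range.2 (gen_dvd_delta hr),
    fun _ hm => delta_dvd he hr fun a => hm _ ⟨a, rfl⟩⟩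

theorem star_delta (he : 2 ≤ e) (hr : 2 ≤ r) : star (Delta e r) = Delta e r := by
  refine isAdditiveLength_len.star_eq_self_of_dvd (delta_dvd he hr fun a => ?_)
  have hΔ := isGarsideElement_delta (r := r) (one_le_two.trans he) hr
  rw [← neg_neg a, ← star_gen, ← rightDvd_iff_star_dvd_star]
  exact (hΔ.balanced _).1 (gen_dvd_delta hr a.neg)

theorem star_image_generators : star '' generators e r = generators e r := by
  rw [generators, ← Set.range_comp]
  exact Function.Surjective.range_comp (f := neg) (fun a => ⟨a.neg, neg_neg a⟩) gen

theorem isLeftLcm_delta (he : 2 ≤ e) (hr : 2 ≤ r) : IsLeftLcm (generators e r) (Delta e r) := by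
  rw [isLeftLcm_iff_isRightLcm_star, star_image_generators, star_delta he hr]
  exact isRightLcm_delta he hr

theorem delta_dvd_of_isGarsideElement (he : 2 ≤ e) (hr : 2 ≤ r) {g : BraidMonoid e r}
    (hg : IsGarsideElement g) : Delta e r ∣ g :=
  delta_dvd he hr hg.gen_dvd

end Lcm

end Garside

theorem theorem3p2 (e r : ℕ) (he : 1 ≤ e) (hr : 2 ≤ r) :
    Garside.IsGarsideMonoid (Garside.BraidMonoid e r) ∧
    Garside.IsGarsideElement (Garside.Delta e r) ∧
    (2 ≤ e →
      Garside.IsRightLcm (Garside.generators e r) (Garside.Delta e r) ∧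
      Garside.IsLeftLcm (Garside.generators e r) (Garside.Delta e r) ∧
      ∀ g : Garside.BraidMonoid e r, Garside.IsGarsideElement g → Garside.Delta e r ∣ g) :=
  ⟨Garside.isGarsideMonoid he hr, Garside.isGarsideElement_delta he hr, fun he' =>
    ⟨Garside.isRightLcm_delta he' hr, Garside.isLeftLcm_delta he' hr,
      fun _ hg => Garside.delta_dvd_of_isGarsideElement he' hr hg⟩⟩
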